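/- Consider a network of $n$ queues whose state is $x\in\mathbb{Z}_{\ge 0}^n$. There are $m_e$ exit events and $m_u$ routing events. Exit event $j$ removes one unit from a queue $e(j)$ and occurs at rate $\gamma_j x_{e(j)}$ with $\gamma_j\ge 0$. Routing event $k$ moves one unit from queue $s(k)$ to queue $d(k)\neq s(k)$ and occurs at rate $u_k x_{s(k)}$, where $u_k\in[0,u_{\max}]$ is a control input and $u_{\max}>0$. Let $R_E$ and $R_D$ be the matrices whose columns are the state changes of the exit and routing events, $\Gamma=\mathrm{diag}(\gamma_j)$, $U=\mathrm{diag}(u_k)$, and let $E,H$ be the $0/1$ matrices with $E_{ji}=1$ iff $e(j)=i$ and $H_{ki}=1$ iff $s(k)=i$. A time-invariant feedback policy is an arbitrary map $x\mapsto U(x)=\mathrm{diag}(u_k(x))$ with $u_k(x)\in[0,u_{\max}]$. Under such a policy, $X(t)$ is the Markov jump process started from $X(0)=x_0$ whose law $\mathbb{P}(\cdot,t)$ solves the Kolmogorov (master) equation with these events and rates. For vectors $q\in\mathbb{R}^n$ and $v\in\mathbb{R}^{m_u}$ with nonnegative entries, define the cost $$\mathcal{V}_U(x_0)=\lim_{T\to\infty}\mathbb{E}\Big[\int_0^T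 \big(q^TX(t)+v^TU(X(t))HX(t)\big)\,dt\;\Big|\;X(0)=x_0\Big]\in[0,\infty].$$ Assume that from every queue there is a directed path of routing events (possibly of length $0$) to a queue that has an exit event with $\gamma_j\neq 0$. Consider the algebraic equation for $y\in\mathbb{R}^n$ (with $|\cdot|$ taken elementwise) $$q^T+y^TR_E\Gamma E+\frac{u_{\max}}{2}\Big((y^TR_D+v^T)-|y^TR_D+v^T|\Big)H=0,$$ subject to the normalization that $y_i=0$ for each queue $i$ with $q_i=0$ that has no exit event of nonzero rate. (This normalization is void if every queue without service has $q_i>0$.) Then: 1. The equation has a solution satisfying the normalization. 2. For every such solution $y$, the constant bang-bang policy $$U^*=\mathrm{diag}\Big(\frac{u_{\max}}{2}\big(\mathbf{1}-\mathrm{sgn}(y^TR_D+v^T)\big)\Big),$$ which depends neither on the state nor on time, is optimal among time-invariant feedback policies: for every initial state $x_0$ it attains $\min_U\mathcal{V}_U(x_0)$, and this minimum equals $y^Tx_0\ge 0$. Here $\mathrm{sgn}$ acts elementwise, with $\mathrm{sgn}(a)=1$ for $a>0$ and $\mathrm{sgn}(a)=-1$ for $a<0$, and $\mathrm{sgn}(0)$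 may be given any fixed value in $[-1,1]$. -/

import Mathlib

open Filter Topology MeasureTheory
open scoped ENNReal Matrix

noncomputable section

/-- States of the network: `x i` is the number of units in queue `i`. -/
abbrev QState (n : ℕ) : Type := Fin n → ℕ

/-- A network of `n` queues with `mE` exit events and `mD` controlled routing events.
Exit event `j` removes a unit from queue `exitQueue j`, at rate `exitRate j` per unit present;
routing event `k` moves a unit from queue `src k` to queue `dst k`. -/
structure QueueNetwork (n mE mD : ℕ) where
  exitQueue : Fin mE → Fin n
  exitRate : Fin mE → ℝ
  exitRate_nonneg : ∀ j, 0 ≤ exitRate j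
  src : Fin mD → Fin n
  dst : Fin mD → Fin n
  src_ne_dst : ∀ k, src k ≠ dst k

/-- Time-invariant state feedback policies: the control signals `u k` are arbitrary functions of
the state with values in the admissible set `[0, umax]`. -/
abbrev FeedbackPolicy (n mD : ℕ) (umax : ℝ) : Type :=
  QState n → Fin mD → Set.Icc (0 : ℝ) umax

/-- The diagonal control matrix `U(x) = diag(u k (x))`. -/
def FeedbackPolicy.mat {n mD : ℕ} {umax : ℝ} (U : FeedbackPolicy n mD umax) (x : QState n) :
    Matrix (Fin mD) (Fin mD) ℝ :=
  Matrix.diagonal fun k => (U x k : ℝ)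

namespace QueueNetwork

variable {n mE mD : ℕ} (net : QueueNetwork n mE mD) {umax : ℝ}

/-- State change of exit event `j`. -/
def exitJump (j : Fin mE) : Fin n → ℤ :=
  -Pi.single (net.exitQueue j) 1

/-- State change of routing event `k`. -/
def routeJump (k : Fin mD) : Fin n → ℤ :=
  Pi.single (net.dst k) 1 - Pi.single (net.src k) 1

/-- The matrix `R_E` whose columns are the state changes of the exit events. -/
def RE : Matrix (Fin n) (Fin mE) ℝ :=
  Matrix.of fun i j => (net.exitJump j i : ℝ)

/-- The matrix `R_D` whose columns are the state changes of the routing events. -/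
def RD : Matrix (Fin n) (Fin mD) ℝ :=
  Matrix.of fun i k => (net.routeJump k i : ℝ)

/-- The diagonal matrix of exit rates. -/
def Γ : Matrix (Fin mE) (Fin mE) ℝ :=
  Matrix.diagonal net.exitRate

/-- The 0/1 matrix with `E j i = 1` iff exit event `j` occurs at queue `i`. -/
def E : Matrix (Fin mE) (Fin n) ℝ :=
  Matrix.of fun j i => if net.exitQueue j = i then 1 else 0

/-- The 0/1 matrix with `H k i = 1` iff routing event `k` has source queue `i`. -/
def H : Matrix (Fin mD) (Fin n) ℝ :=
  Matrix.of fun k i => if net.src k = i then 1 else 0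

/-- Every queue has a directed path of routing events to a queue with nonzero exit rate. -/
def EveryQueueReachesExit : Prop :=
  ∀ i : Fin n, ∃ j : Fin mE, net.exitRate j ≠ 0 ∧
    Relation.ReflTransGen (fun a b => ∃ k, net.src k = a ∧ net.dst k = b) i (net.exitQueue j)

/-- Rate of exit event `j` in state `x`. -/
def exitEventRate (j : Fin mE) (x : QState n) : ℝ :=
  net.exitRate j * (x (net.exitQueue j) : ℝ)

/-- Rate of routing event `k` in state `x` under the policy `U`. -/
def routeEventRate (U : FeedbackPolicy n mD umax) (k : Fin mD) (x : QState n) : ℝ :=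
  (U x k : ℝ) * (x (net.src k) : ℝ)

/-- The term `W(x - r) p(x - r)`, read as `0` when `x - r` is not a state. -/
def inflow (r : Fin n → ℤ) (W p : QState n → ℝ) (x : QState n) : ℝ :=
  if ∀ l, 0 ≤ (x l : ℤ) - r l then
    W (fun l => ((x l : ℤ) - r l).toNat) * p (fun l => ((x l : ℤ) - r l).toNat)
  else 0

/-- Right-hand side of the master (forward Kolmogorov) equation. -/
def masterRHS (U : FeedbackPolicy n mD umax) (p : QState n → ℝ) (x : QState n) : ℝ :=
  ∑ j, (inflow (net.exitJump j) (net.exitEventRate j) p x - net.exitEventRate j x * p x) +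
  ∑ k, (inflow (net.routeJump k) (net.routeEventRate U k) p x - net.routeEventRate U k x * p x)

/-- `P t` (for `t ≥ 0`) is the law at time `t` of the Markov jump process of the network driven by
the policy `U` and started from `x₀`: it solves the master equation with initial law `δ_{x₀}`. -/
structure IsMasterSolution (U : FeedbackPolicy n mD umax) (x₀ : QState n)
    (P : ℝ → PMF (QState n)) : Prop where
  init : P 0 = PMF.pure x₀
  deriv : ∀ t, 0 ≤ t → ∀ x, HasDerivWithinAt (fun s => (P s x).toReal)
    (net.masterRHS U (fun z => (P t z).toReal) x) (Set.Ici 0) t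

/-! ### Existence of the solution of the master equation -/

/-- States with at most `N` units. -/
abbrev Lev (n N : ℕ) : Type := {x : QState n // ∑ i, x i ≤ N}

instance levFinite (n N : ℕ) : Finite (Lev n N) := by
  refine Set.Finite.to_subtype (s := {x : QState n | ∑ i, x i ≤ N}) ?_
  refine (Set.finite_Iic (fun _ : Fin n => N)).subset ?_
  intro x hx i
  exact (Finset.single_le_sum (f := x) (fun _ _ => Nat.zero_le _) (Finset.mem_univ i)).trans hx

instance levFintype (n N : ℕ) : Fintype (Lev n N) := Fintype.ofFinite _

/-- Extension by zero. -/
def ext0 {N : ℕ} (p : Lev n N → ℝ) (x : QState n) : ℝ :=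
  if h : ∑ i, x i ≤ N then p ⟨x, h⟩ else 0

lemma inflow_ext0_zero (r : Fin n → ℤ) (W : QState n → ℝ) (hr : ∑ l, r l ≤ 0) {N : ℕ}
    (p : Lev n N → ℝ) (x : QState n) (hx : ¬ ∑ i, x i ≤ N) : inflow r W (ext0 p) x = 0 := by
  unfold inflow
  split_ifs with h
  · have : ¬ (∑ l, ((x l : ℤ) - r l).toNat ≤ N) := by
      intro hle
      apply hx
      zify at hle ⊢
      have h2 : ∑ l, ((((x l : ℤ) - r l).toNat : ℕ) : ℤ) = ∑ l, ((x l : ℤ) - r l) :=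
        Finset.sum_congr rfl fun l _ => Int.toNat_of_nonneg (h l)
      rw [h2, Finset.sum_sub_distrib] at hle
      linarith
    simp [ext0, this]
  · rfl

lemma sum_inflow (r : Fin n → ℤ) (W : QState n → ℝ) (hr : ∑ l, r l ≤ 0)
    (hW : ∀ x, W x ≠ 0 → ∀ l, 0 ≤ (x l : ℤ) + r l) {N : ℕ} (p : Lev n N → ℝ) :
    ∑ s : Lev n N, inflow r W (ext0 p) s.1 = ∑ s : Lev n N, W s.1 * ext0 p s.1 := by
  classical
  have hcond : ∀ s : Lev n N, inflow r W (ext0 p) s.1 ≠ 0 →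
      (∀ l, 0 ≤ (s.1 l : ℤ) - r l) ∧ ∑ l, ((s.1 l : ℤ) - r l).toNat ≤ N := by
    intro s hs
    have h1 : ∀ l, 0 ≤ (s.1 l : ℤ) - r l := by
      by_contra h; exact hs (if_neg h)
    refine ⟨h1, ?_⟩
    by_contra h
    exact hs (by simp [inflow, ext0, h])
  refine Finset.sum_bij_ne_zero
    (fun s _ hs => (⟨fun l => ((s.1 l : ℤ) - r l).toNat, (hcond s hs).2⟩ : Lev n N)) ?_ ?_ ?_ ?_
  · intros; exact Finset.mem_univ _
  · intro a _ ha b _ hb hab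
    have h := congrArg Subtype.val hab
    apply Subtype.ext
    funext l
    have hl := congrFun h l
    have h1 := (hcond a ha).1 l
    have h2 := (hcond b hb).1 l
    simp only at hl
    omega
  · intro b _ hb
    have hWb : W b.1 ≠ 0 := fun h => hb (by simp [h])
    have h1 := hW _ hWb
    have hN : ∑ l, ((b.1 l : ℤ) + r l).toNat ≤ N := by
      have hb2 := b.2
      zify at hb2 ⊢
      have h2 : ∑ l, ((((b.1 l : ℤ) + r l).toNat : ℕ) : ℤ) = ∑ l, ((b.1 l : ℤ) + r l) :=
        Finset.sum_congr rfl fun l _ => Int.toNat_of_nonneg (h1 l)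
      rw [h2, Finset.sum_add_distrib]
      linarith
    have hback : (fun l => (((((b.1 l : ℤ) + r l).toNat : ℕ) : ℤ) - r l).toNat) = b.1 := by
      funext l
      have := h1 l
      omega
    have hc : ∀ l, 0 ≤ ((((b.1 l : ℤ) + r l).toNat : ℕ) : ℤ) - r l := by
      intro l
      have := h1 l
      omega
    have hval : inflow r W (ext0 p) (fun l => ((b.1 l : ℤ) + r l).toNat) = W b.1 * ext0 p b.1 := by
      unfold inflow
      rw [if_pos hc, hback]
    refine ⟨⟨_, hN⟩, Finset.mem_univ _, ?_, ?_⟩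
    · rw [hval]; exact hb
    · exact Subtype.ext hback
  · intro a _ ha
    simp only [inflow, if_pos (hcond a ha).1]

lemma ext0_add {N : ℕ} (p q : Lev n N → ℝ) : ext0 (p + q) = ext0 p + ext0 q := by
  funext x; by_cases h : ∑ i, x i ≤ N <;> simp [ext0, h]

lemma ext0_smul {N : ℕ} (c : ℝ) (p : Lev n N → ℝ) : ext0 (c • p) = c • ext0 p := by
  funext x; by_cases h : ∑ i, x i ≤ N <;> simp [ext0, h]

lemma inflow_add (r : Fin n → ℤ) (W p q : QState n → ℝ) (x : QState n) :
    inflow r W (p + q) x = inflow r W p x + inflow r W q x := by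
  unfold inflow; split_ifs <;> simp [mul_add]

lemma inflow_smul (r : Fin n → ℤ) (c : ℝ) (W p : QState n → ℝ) (x : QState n) :
    inflow r W (c • p) x = c * inflow r W p x := by
  unfold inflow; split_ifs <;> simp [mul_left_comm]

lemma inflow_nonneg (r : Fin n → ℤ) (W p : QState n → ℝ) (hW : ∀ x, 0 ≤ W x)
    (hp : ∀ x, 0 ≤ p x) (x : QState n) : 0 ≤ inflow r W p x := by
  unfold inflow; split_ifs
  · exact mul_nonneg (hW _) (hp _)
  · exact le_rfl

lemma masterRHS_add (U : FeedbackPolicy n mD umax) (p q : QState n → ℝ) (x : QState n) :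
    net.masterRHS U (p + q) x = net.masterRHS U p x + net.masterRHS U q x := by
  simp only [masterRHS, inflow_add, Pi.add_apply, mul_add, Finset.sum_sub_distrib,
    Finset.sum_add_distrib]
  ring

lemma masterRHS_smul (U : FeedbackPolicy n mD umax) (c : ℝ) (p : QState n → ℝ) (x : QState n) :
    net.masterRHS U (c • p) x = c * net.masterRHS U p x := by
  simp only [masterRHS, inflow_smul, Pi.smul_apply, smul_eq_mul, mul_add, Finset.mul_sum, mul_sub]
  congr 1 <;> refine Finset.sum_congr rfl fun _ _ => ?_ <;> ring

/-- The master equation restricted to states with at most `N` units. -/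
def levGen (U : FeedbackPolicy n mD umax) (N : ℕ) : (Lev n N → ℝ) →L[ℝ] (Lev n N → ℝ) :=
  LinearMap.toContinuousLinearMap
    { toFun := fun p s => net.masterRHS U (ext0 p) s.1
      map_add' := fun p q => by
        funext s; simp only [ext0_add, masterRHS_add, Pi.add_apply]
      map_smul' := fun c p => by
        funext s
        simp only [ext0_smul, masterRHS_smul, Pi.smul_apply, smul_eq_mul, RingHom.id_apply] }

lemma levGen_apply (U : FeedbackPolicy n mD umax) (N : ℕ) (p : Lev n N → ℝ) (s : Lev n N) :
    net.levGen U N p s = net.masterRHS U (ext0 p) s.1 := rfl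

lemma exitEventRate_nonneg (j : Fin mE) (x : QState n) : 0 ≤ net.exitEventRate j x :=
  mul_nonneg (net.exitRate_nonneg j) (Nat.cast_nonneg _)

lemma routeEventRate_nonneg (U : FeedbackPolicy n mD umax) (k : Fin mD) (x : QState n) :
    0 ≤ net.routeEventRate U k x :=
  mul_nonneg (U x k).2.1 (Nat.cast_nonneg _)

lemma sum_exitJump (j : Fin mE) : ∑ l, net.exitJump j l ≤ 0 := by
  simp [exitJump]

lemma sum_routeJump (k : Fin mD) : ∑ l, net.routeJump k l ≤ 0 := by
  simp [routeJump]

lemma exit_feasible (j : Fin mE) (x : QState n) (h : net.exitEventRate j x ≠ 0) (l : Fin n) :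
    0 ≤ (x l : ℤ) + net.exitJump j l := by
  have hx : x (net.exitQueue j) ≠ 0 := fun h0 => h (by simp [exitEventRate, h0])
  by_cases hl : l = net.exitQueue j
  · subst hl; simp [exitJump]; omega
  · simp [exitJump, hl]

lemma route_feasible (U : FeedbackPolicy n mD umax) (k : Fin mD) (x : QState n)
    (h : net.routeEventRate U k x ≠ 0) (l : Fin n) : 0 ≤ (x l : ℤ) + net.routeJump k l := by
  have hx : x (net.src k) ≠ 0 := fun h0 => h (by simp [routeEventRate, h0])
  by_cases hl : l = net.src k
  · subst hl; simp [routeJump, net.src_ne_dst k]; omega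
  · simp only [routeJump, Pi.sub_apply, Pi.single_apply, hl, if_false]
    split_ifs <;> omega

lemma sum_levGen (U : FeedbackPolicy n mD umax) (N : ℕ) (p : Lev n N → ℝ) :
    ∑ s, net.levGen U N p s = 0 := by
  simp only [levGen_apply, masterRHS, Finset.sum_add_distrib]
  rw [Finset.sum_comm, Finset.sum_comm (s := (Finset.univ : Finset (Lev n N)))
    (t := (Finset.univ : Finset (Fin mD)))]
  simp only [Finset.sum_sub_distrib]
  simp only [sum_inflow _ _ (net.sum_exitJump _) (net.exit_feasible _),
    sum_inflow _ _ (net.sum_routeJump _) (net.route_feasible U _), sub_self, add_zero]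

lemma ext0_nonneg {N : ℕ} (p : Lev n N → ℝ) (hp : 0 ≤ p) (x : QState n) : 0 ≤ ext0 p x := by
  unfold ext0; split_ifs
  · exact hp _
  · exact le_rfl

lemma exists_shift (U : FeedbackPolicy n mD umax) (N : ℕ) :
    ∃ c : ℝ, ∀ p : Lev n N → ℝ, 0 ≤ p → 0 ≤ net.levGen U N p + c • p := by
  let R : Lev n N → ℝ := fun s =>
    ∑ j, net.exitEventRate j s.1 + ∑ k, net.routeEventRate U k s.1
  have hR : ∀ s, 0 ≤ R s := fun s => add_nonneg
    (Finset.sum_nonneg fun j _ => net.exitEventRate_nonneg j s.1)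
    (Finset.sum_nonneg fun k _ => net.routeEventRate_nonneg U k s.1)
  refine ⟨∑ s, R s, fun p hp s => ?_⟩
  have hs : R s ≤ ∑ s, R s := Finset.single_le_sum (fun s _ => hR s) (Finset.mem_univ s)
  have hps : ext0 p s.1 = p s := by simp [ext0, s.2]
  have h1 : 0 ≤ ∑ j, inflow (net.exitJump j) (net.exitEventRate j) (ext0 p) s.1 :=
    Finset.sum_nonneg fun j _ =>
      inflow_nonneg _ _ _ (net.exitEventRate_nonneg j) (ext0_nonneg p hp) _
  have h2 : 0 ≤ ∑ k, inflow (net.routeJump k) (net.routeEventRate U k) (ext0 p) s.1 :=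
    Finset.sum_nonneg fun k _ =>
      inflow_nonneg _ _ _ (net.routeEventRate_nonneg U k) (ext0_nonneg p hp) _
  have h3 := mul_le_mul_of_nonneg_right hs (hp s)
  simp only [Pi.add_apply, Pi.smul_apply, smul_eq_mul, levGen_apply, masterRHS, hps,
    Finset.sum_sub_distrib, ← Finset.sum_mul, Pi.zero_apply]
  simp only [R, add_mul] at h3 ⊢
  linarith

/-- Solution of the master equation on the states with at most `N` units. -/
lemma exists_lev_solution (U : FeedbackPolicy n mD umax) (N : ℕ) (s₀ : Lev n N) :
    ∃ p : ℝ → Lev n N → ℝ, p 0 = Pi.single s₀ 1 ∧ (∀ t, 0 ≤ t → 0 ≤ p t) ∧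
      (∀ t, ∑ s, p t s = 1) ∧ ∀ t, HasDerivAt p (net.levGen U N (p t)) t := by
  classical
  obtain ⟨c, hc⟩ := net.exists_shift U N
  let B : (Lev n N → ℝ) →L[ℝ] (Lev n N → ℝ) :=
    net.levGen U N + c • ContinuousLinearMap.id ℝ (Lev n N → ℝ)
  let δ : Lev n N → ℝ := Pi.single s₀ 1
  have hδ : 0 ≤ δ := by
    intro s; by_cases h : s = s₀ <;> simp [δ, h]
  have hB : ∀ p : Lev n N → ℝ, 0 ≤ p → 0 ≤ B p := fun p hp => hc p hp
  have hBn : ∀ m : ℕ, 0 ≤ (B ^ m) δ := by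
    intro m
    induction m with
    | zero => simpa using hδ
    | succ m ih => rw [pow_succ']; exact hB _ ih
  let p : ℝ → Lev n N → ℝ := fun t => Real.exp (-(c * t)) • (NormedSpace.exp (t • B)) δ
  have hp0 : p 0 = δ := by simp [p]
  have hderiv : ∀ t, HasDerivAt p (net.levGen U N (p t)) t := by
    intro t
    have h1 : HasDerivAt (fun u : ℝ => (NormedSpace.exp (u • B)) δ)
        ((B * NormedSpace.exp (t • B)) δ) t :=
      (hasDerivAt_exp_smul_const' (𝕂 := ℝ) B t).clm_apply (hasDerivAt_const t δ) |>.congr_deriv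
        (by simp)
    have h2 : HasDerivAt (fun u : ℝ => Real.exp (-(c * u))) (Real.exp (-(c * t)) * (-(c * 1))) t :=
      (((hasDerivAt_id t).const_mul c).neg).exp
    refine (h2.smul h1).congr_deriv ?_
    have h3 : (B * NormedSpace.exp (t • B)) δ =
        net.levGen U N ((NormedSpace.exp (t • B)) δ) + c • (NormedSpace.exp (t • B)) δ := rfl
    rw [h3]
    simp only [p, map_smul, smul_add, mul_one]
    module
  refine ⟨p, hp0, ?_, ?_, hderiv⟩
  · intro t ht s
    have h1 : HasSum (fun m : ℕ => ((m.factorial : ℝ)⁻¹) • (t • B) ^ m) (NormedSpace.exp (t • B)) :=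
      NormedSpace.exp_series_hasSum_exp' (𝕂 := ℝ) (t • B)
    have h2 := (ContinuousLinearMap.apply ℝ (Lev n N → ℝ) δ).hasSum h1
    have h3 := Pi.hasSum.1 h2 s
    have h4 : 0 ≤ (NormedSpace.exp (t • B)) δ s := by
      refine h3.nonneg fun m => ?_
      simp only [ContinuousLinearMap.apply_apply, smul_apply, smul_pow,
        Pi.smul_apply, smul_eq_mul]
      exact mul_nonneg (by positivity) (mul_nonneg (by positivity) (hBn m s))
    exact mul_nonneg (Real.exp_pos _).le h4
  · intro t
    have hd : ∀ u, HasDerivAt (fun u => ∑ s, p u s) 0 u := by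
      intro u
      have := HasDerivAt.fun_sum (u := Finset.univ) fun s _ => hasDerivAt_pi.1 (hderiv u) s
      rwa [net.sum_levGen U N] at this
    have hconst := is_const_of_deriv_eq_zero (fun u => (hd u).differentiableAt)
      (fun u => (hd u).deriv) t 0
    rw [hconst, hp0]
    simp [δ]

theorem exists_masterSolution (U : FeedbackPolicy n mD umax) (x₀ : QState n) :
    ∃ P : ℝ → PMF (QState n), net.IsMasterSolution U x₀ P := by
  classical
  set N := ∑ i, x₀ i with hN
  obtain ⟨p, hp0, hpos, hsum, hderiv⟩ := net.exists_lev_solution U N ⟨x₀, le_rfl⟩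
  have hval : ∀ t, 0 ≤ t → ∀ x, 0 ≤ ext0 (p t) x := fun t ht => ext0_nonneg _ (hpos t ht)
  let F : Finset (QState n) := Finset.univ.map (Function.Embedding.subtype fun x : QState n =>
    ∑ i, x i ≤ N)
  have hF : ∀ t, ∀ x ∉ F, ext0 (p t) x = 0 := by
    intro t x hx
    have : ¬ ∑ i, x i ≤ N := fun h => hx (by simp [F, h])
    simp [ext0, this]
  have hFs : ∀ t, ∑ x ∈ F, ext0 (p t) x = 1 := by
    intro t
    rw [Finset.sum_map, ← hsum t]
    refine Finset.sum_congr rfl fun s _ => ?_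
    simp [ext0, s.2]
  let P : ℝ → PMF (QState n) := fun t =>
    PMF.ofFinset (fun x => ENNReal.ofReal (ext0 (p (max t 0)) x)) F
      (by rw [← ENNReal.ofReal_sum_of_nonneg fun x _ => hval _ (le_max_right _ _) x, hFs,
            ENNReal.ofReal_one])
      (fun x hx => by simp [hF _ x hx])
  have hP : ∀ t, 0 ≤ t → ∀ x, (P t x).toReal = ext0 (p t) x := by
    intro t ht x
    simp only [P, PMF.ofFinset_apply, max_eq_left ht]
    exact ENNReal.toReal_ofReal (hval t ht x)
  refine ⟨P, ?_, ?_⟩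
  · ext x
    simp only [P, PMF.ofFinset_apply, max_self, hp0, PMF.pure_apply]
    by_cases h : x = x₀
    · subst h; simp [ext0, hN]
    · by_cases h' : ∑ i, x i ≤ N
      · simp [ext0, h, h']
      · simp [ext0, h, h']
  · intro t ht x
    have hfun : (fun z => (P t z).toReal) = ext0 (p t) := funext fun z => hP t ht z
    rw [hfun]
    have key : HasDerivAt (fun s => ext0 (p s) x) (net.masterRHS U (ext0 (p t)) x) t := by
      by_cases h : ∑ i, x i ≤ N
      · have h1 := hasDerivAt_pi.1 (hderiv t) ⟨x, h⟩
        simpa only [ext0, h, dif_pos, levGen_apply] using h1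
      · have h0 : net.masterRHS U (ext0 (p t)) x = 0 := by
          have hx : ext0 (p t) x = 0 := by simp [ext0, h]
          simp only [masterRHS, hx, mul_zero, sub_zero,
            inflow_ext0_zero _ _ (net.sum_exitJump _) (p t) x h,
            inflow_ext0_zero _ _ (net.sum_routeJump _) (p t) x h, Finset.sum_const_zero, add_zero]
        rw [h0]
        simpa only [ext0, h, dif_neg, not_false_eq_true] using hasDerivAt_const t (0 : ℝ)
    exact key.hasDerivWithinAt.congr (fun s hs => hP s hs x) (hP t ht x)

/-- `net.law U x₀ t` is the law `ℙ(·, t)` of the state at time `t ≥ 0`. -/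
def law (U : FeedbackPolicy n mD umax) (x₀ : QState n) : ℝ → PMF (QState n) :=
  (net.exists_masterSolution U x₀).choose

lemma law_spec (U : FeedbackPolicy n mD umax) (x₀ : QState n) :
    net.IsMasterSolution U x₀ (net.law U x₀) :=
  (net.exists_masterSolution U x₀).choose_spec

/-! ### Costs -/

/-- The stage cost `qᵀ x + vᵀ U H x` for a control matrix `U`. -/
def stageCost (q : Fin n → ℝ) (v : Fin mD → ℝ) (x : QState n) (U : Matrix (Fin mD) (Fin mD) ℝ) :
    ℝ :=
  q ⬝ᵥ (fun i => (x i : ℝ)) + v ⬝ᵥ (U *ᵥ (net.H *ᵥ fun i => (x i : ℝ)))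

/-- The expected cost `𝔼[∫₀ᵀ g(X(t), U(X(t))) dt | X(0) = x₀]`, with the expectation taken under
the law of `X(t)`. -/
def costUpTo (q : Fin n → ℝ) (v : Fin mD → ℝ) (U : FeedbackPolicy n mD umax) (x₀ : QState n)
    (T : ℝ) : ℝ≥0∞ :=
  ∫⁻ t in Set.Icc 0 T, ∫⁻ x, ENNReal.ofReal (net.stageCost q v x (U.mat x))
    ∂(net.law U x₀ t).toMeasure

/-- The infinite-horizon cost `𝒱_U(x₀) = lim_{T → ∞} 𝔼[∫₀ᵀ g dt | X(0) = x₀]`. -/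
def cost (q : Fin n → ℝ) (v : Fin mD → ℝ) (U : FeedbackPolicy n mD umax) (x₀ : QState n) : ℝ≥0∞ :=
  limUnder atTop (net.costUpTo q v U x₀)

lemma tendsto_costUpTo (q : Fin n → ℝ) (v : Fin mD → ℝ) (U : FeedbackPolicy n mD umax)
    (x₀ : QState n) : Tendsto (net.costUpTo q v U x₀) atTop (𝓝 (net.cost q v U x₀)) := by
  have hmono : Monotone (net.costUpTo q v U x₀) := fun S T h =>
    lintegral_mono_set (Set.Icc_subset_Icc_right h)
  unfold cost
  rw [(tendsto_atTop_iSup hmono).limUnder_eq]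
  exact tendsto_atTop_iSup hmono

/-- For any process `X` on a probability space whose one-dimensional laws are those of the
network, `costUpTo` is the expectation of the pathwise integral of the stage cost. -/
lemma lintegral_process_eq_costUpTo (q : Fin n → ℝ) (v : Fin mD → ℝ)
    (U : FeedbackPolicy n mD umax) (x₀ : QState n) {Ω : Type*} [MeasurableSpace Ω]
    (μ : Measure Ω) [IsProbabilityMeasure μ] (X : ℝ → Ω → QState n)
    (hX : Measurable (Function.uncurry X))
    (hlaw : ∀ t, 0 ≤ t → μ.map (X t) = (net.law U x₀ t).toMeasure) (T : ℝ) :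
    ∫⁻ ω, (∫⁻ t in Set.Icc 0 T,
      ENNReal.ofReal (net.stageCost q v (X t ω) (U.mat (X t ω)))) ∂μ = net.costUpTo q v U x₀ T := by
  have hg : Measurable fun x : QState n => ENNReal.ofReal (net.stageCost q v x (U.mat x)) :=
    measurable_of_countable _
  rw [lintegral_lintegral_swap]
  · refine setLIntegral_congr_fun measurableSet_Icc fun t ht => ?_
    have hXt : Measurable (X t) := hX.comp measurable_prodMk_left
    rw [← hlaw t ht.1, lintegral_map hg hXt]
  · exact (hg.comp (hX.comp measurable_swap)).aemeasurable

/-! ### The bang-bang policy -/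

/-- The algebraic equation
`qᵀ + yᵀ R_E Γ E + (umax/2) ((yᵀ R_D + vᵀ) - |yᵀ R_D + vᵀ|) H = 0`. -/
def SolvesAlgebraicEq (umax : ℝ) (q : Fin n → ℝ) (v : Fin mD → ℝ) (y : Fin n → ℝ) : Prop :=
  q + y ᵥ* (net.RE * net.Γ * net.E) +
    (umax / 2) • (((y ᵥ* net.RD + v) - |y ᵥ* net.RD + v|) ᵥ* net.H) = 0

end QueueNetwork

/-- The sign function with value `θ` at `0`. -/
def sgn (θ : ℝ) (x : ℝ) : ℝ := if 0 < x then 1 else if x < 0 then -1 else θ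

lemma sgn_mem {θ : ℝ} (hθ : θ ∈ Set.Icc (-1 : ℝ) 1) (x : ℝ) : sgn θ x ∈ Set.Icc (-1 : ℝ) 1 := by
  unfold sgn; split_ifs
  · norm_num
  · norm_num
  · exact hθ

namespace QueueNetwork

variable {n mE mD : ℕ} (net : QueueNetwork n mE mD)

/-- The constant bang-bang policy `diag((umax/2) (1 - sgn(yᵀ R_D + vᵀ)))`. -/
def bangBang {umax : ℝ} (humax : 0 ≤ umax) {θ : ℝ} (hθ : θ ∈ Set.Icc (-1 : ℝ) 1)
    (v : Fin mD → ℝ) (y : Fin n → ℝ) : FeedbackPolicy n mD umax := fun _ k =>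
  ⟨umax / 2 * (1 - sgn θ ((y ᵥ* net.RD + v) k)), by
    have h := sgn_mem hθ ((y ᵥ* net.RD + v) k)
    exact ⟨mul_nonneg (by linarith) (by linarith [h.2]), by nlinarith [h.1]⟩⟩

lemma bangBang_mat {umax : ℝ} (humax : 0 ≤ umax) {θ : ℝ} (hθ : θ ∈ Set.Icc (-1 : ℝ) 1)
    (v : Fin mD → ℝ) (y : Fin n → ℝ) (x : QState n) :
    (net.bangBang humax hθ v y).mat x =
      Matrix.diagonal ((umax / 2) • (1 - fun k => sgn θ ((y ᵥ* net.RD + v) k))) := rfl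

end QueueNetwork

end

/-! All rates are linear in the state and each routing rate is linear in its own control, so the
optimal cost is sought as a linear function `y ⬝ᵥ x`. For such a function the Bellman equation
decouples over queues and routing events: minimizing `u * c` over `u ∈ [0, umax]` gives `umax * min
0 c = (umax / 2) * (c - |c|)`, and the coefficient of each `x i` gives the algebraic equation. The
bang-bang policy attains every minimum at once.

Verification rests on Dynkin's formula. The expected cost up to `T` equals `y ⬝ᵥ x₀`, minus the
expectation of `y ⬝ᵥ X(T)`, plus the integrated Bellman residual (`linValue_sub_expect_eq`). The
residual is nonnegative for every policy and zero for the bang-bang one. Since `y ≥ 0`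
(`solution_nonneg`), the bang-bang cost is at most `y ⬝ᵥ x₀`. Conversely, for a policy of finite
cost the terminal term becomes arbitrarily small (`exists_expect_lt`): the normalization bounds `y`
by a multiple of `q` plus the service rates, and both have a bounded time integral, the first by the
cost and the second because at most the initial population can exit. Hence no policy costs less than
`y ⬝ᵥ x₀`.

Existence of `y` comes from monotone value iteration between zero and a supersolution built from the
distance to an exit (`exists_normalized_solution`). -/

namespace QueueNetwork

variable {n mE mD : ℕ} (net : QueueNetwork n mE mD) {umax : ℝ}

/-! ### The algebraic equation in coordinates -/

lemma vecMul_RE (y : Fin n → ℝ) (j : Fin mE) : (y ᵥ* net.RE) j = -y (net.exitQueue j) := by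
  simp [Matrix.vecMul, dotProduct, RE, exitJump, Pi.single_apply]

lemma vecMul_RD (y : Fin n → ℝ) (k : Fin mD) :
    (y ᵥ* net.RD) k = y (net.dst k) - y (net.src k) := by
  simp [Matrix.vecMul, dotProduct, RD, routeJump, Pi.single_apply, mul_sub,
    Finset.sum_sub_distrib]

lemma vecMul_H (w : Fin mD → ℝ) (i : Fin n) :
    (w ᵥ* net.H) i = ∑ k, if net.src k = i then w k else 0 := by
  simp [Matrix.vecMul, dotProduct, H]

lemma vecMul_E (w : Fin mE → ℝ) (i : Fin n) :
    (w ᵥ* net.E) i = ∑ j, if net.exitQueue j = i then w j else 0 := by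
  simp [Matrix.vecMul, dotProduct, E]

/-- Total exit rate per unit present in queue `i`. -/
noncomputable def serviceRate (i : Fin n) : ℝ :=
  ∑ j, if net.exitQueue j = i then net.exitRate j else 0

lemma serviceRate_nonneg (i : Fin n) : 0 ≤ net.serviceRate i :=
  Finset.sum_nonneg fun j _ => by split_ifs <;> simp [net.exitRate_nonneg j]

lemma serviceRate_eq_zero_iff (i : Fin n) :
    net.serviceRate i = 0 ↔ ∀ j, net.exitQueue j = i → net.exitRate j = 0 := by
  unfold serviceRate
  rw [Finset.sum_eq_zero_iff_of_nonneg fun j _ => by split_ifs <;> simp [net.exitRate_nonneg j]]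
  simp

/-- Marginal value of routing event `k` for the value function `y`. -/
def routeGain (v : Fin mD → ℝ) (y : Fin n → ℝ) (k : Fin mD) : ℝ :=
  y (net.dst k) - y (net.src k) + v k

/-- Rests on `(c - |c|) / 2 = min 0 c`; the right-hand side is the Bellman equation for one unit in
queue `i`. -/
lemma solvesAlgebraicEq_iff (q : Fin n → ℝ) (v : Fin mD → ℝ) (y : Fin n → ℝ) :
    net.SolvesAlgebraicEq umax q v y ↔ ∀ i, q i - net.serviceRate i * y i +
      umax * ∑ k, (if net.src k = i then min 0 (net.routeGain v y k) else 0) = 0 := by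
  unfold SolvesAlgebraicEq
  rw [funext_iff]
  refine forall_congr' fun i => ?_
  have hE : (y ᵥ* (net.RE * net.Γ * net.E)) i = -(net.serviceRate i * y i) := by
    rw [← Matrix.vecMul_vecMul, ← Matrix.vecMul_vecMul, vecMul_E, serviceRate, Finset.sum_mul,
      ← Finset.sum_neg_distrib]
    refine Finset.sum_congr rfl fun j _ => ?_
    split_ifs with h
    · rw [Γ, Matrix.vecMul_diagonal, vecMul_RE, h]; ring
    · simp
  have hH : (umax / 2) * ((((y ᵥ* net.RD + v) - |y ᵥ* net.RD + v|) ᵥ* net.H) i) =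
      umax * ∑ k, (if net.src k = i then min 0 (net.routeGain v y k) else 0) := by
    rw [vecMul_H, Finset.mul_sum, Finset.mul_sum]
    refine Finset.sum_congr rfl fun k _ => ?_
    split_ifs with h
    · simp only [Pi.sub_apply, Pi.add_apply, Pi.abs_apply, vecMul_RD, routeGain]
      rcases le_total 0 (y (net.dst k) - y (net.src k) + v k) with h0 | h0
      · rw [abs_of_nonneg h0, min_eq_left h0]; ring
      · rw [abs_of_nonpos h0, min_eq_right h0]; ring
    · simp
  simp only [Pi.add_apply, Pi.smul_apply, smul_eq_mul, Pi.zero_apply, hE, hH, ← sub_eq_add_neg]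

/-- Minimum principle: at a queue where `y` is smallest all routing gains are nonnegative, so the
control term drops out. If the minimum were negative, the two remaining terms would be nonnegative
with sum zero, so `q` and the service rate would vanish there and the normalization would force `y =
0`. -/
lemma solution_nonneg {q : Fin n → ℝ} (hq : ∀ i, 0 ≤ q i) {v : Fin mD → ℝ} (hv : ∀ k, 0 ≤ v k)
    {y : Fin n → ℝ} (hy : net.SolvesAlgebraicEq umax q v y)
    (hnorm : ∀ i, q i = 0 → net.serviceRate i = 0 → y i = 0) (i : Fin n) : 0 ≤ y i := by
  have : Nonempty (Fin n) := ⟨i⟩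
  obtain ⟨m, hm⟩ := Finite.exists_min y
  refine le_trans ?_ (hm i)
  by_contra! hneg
  have h := (net.solvesAlgebraicEq_iff q v y).1 hy m
  rw [Finset.sum_eq_zero, mul_zero, add_zero] at h
  · have h1 := mul_nonneg (net.serviceRate_nonneg m) (neg_nonneg.2 hneg.le)
    have h2 := hq m
    have h3 : q m = 0 := by linarith
    have h4 : net.serviceRate m * y m = 0 := by linarith
    have h5 := hnorm m h3 ((mul_eq_zero.1 h4).resolve_right hneg.ne)
    linarith
  · intro k _
    split_ifs with hk
    · have := hm (net.dst k)
      have := hv k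
      exact min_eq_left (by unfold routeGain; rw [hk]; linarith)
    · rfl

/-! ### Existence of a normalized solution -/

lemma exists_rank (hreach : net.EveryQueueReachesExit) :
    ∃ h : Fin n → ℕ, ∀ i, 0 < net.serviceRate i ∨
      ∃ k, net.src k = i ∧ h (net.dst k) < h i := by
  classical
  -- `S m i`: some path of exactly `m` routing events leads from `i` to a queue with service. The
  -- rank is the least such `m`.
  let S : ℕ → Fin n → Prop := fun m =>
    Nat.rec (motive := fun _ => Fin n → Prop) (fun i => 0 < net.serviceRate i)
      (fun _ s i => ∃ k, net.src k = i ∧ s (net.dst k)) m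
  have hS : ∀ i, ∃ m, S m i := by
    intro i
    obtain ⟨j, hj, hp⟩ := hreach i
    induction hp using Relation.ReflTransGen.head_induction_on with
    | refl =>
      refine ⟨0, (net.serviceRate_nonneg _).lt_of_ne' fun h => hj ?_⟩
      exact (net.serviceRate_eq_zero_iff _).1 h j rfl
    | head hab _ ih =>
      obtain ⟨k, rfl, rfl⟩ := hab
      obtain ⟨m, hm⟩ := ih
      exact ⟨m + 1, k, rfl, hm⟩
  refine ⟨fun i => Nat.find (p := fun m => S m i) (hS i), fun i => ?_⟩
  have hi := Nat.find_spec (p := fun m => S m i) (hS i)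
  rcases hf : Nat.find (p := fun m => S m i) (hS i) with _ | m
  · rw [hf] at hi; exact Or.inl hi
  · rw [hf] at hi
    obtain ⟨k, hk, hm⟩ := hi
    exact Or.inr ⟨k, hk, by
      simpa only [hf] using
        Nat.lt_succ_of_le (Nat.find_min' (p := fun m => S m (net.dst k)) (hS _) hm)⟩

/-- The witness grows linearly with the distance to service. At a queue with service the exit term
alone absorbs `q i`; elsewhere one routing event that lowers the rank does. -/
lemma exists_supersolution (hreach : net.EveryQueueReachesExit) (humax : 0 < umax)
    {q : Fin n → ℝ} (hq : ∀ i, 0 ≤ q i) {v : Fin mD → ℝ} (hv : ∀ k, 0 ≤ v k) :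
    ∃ z : Fin n → ℝ, (∀ i, 0 ≤ z i) ∧ ∀ i, q i - net.serviceRate i * z i +
      umax * ∑ k, (if net.src k = i then min 0 (net.routeGain v z k) else 0) ≤ 0 := by
  obtain ⟨h, hh⟩ := net.exists_rank hreach
  have hS := net.serviceRate_nonneg
  -- The three sums dominate each `q i / serviceRate i`, `q i / umax` and `v k`. Queues without
  -- service contribute `0` to the first sum, by division by zero.
  set C : ℝ := ∑ i, q i / net.serviceRate i + ∑ i, q i / umax + ∑ k, v k with hC
  have n1 : ∀ i, 0 ≤ q i / net.serviceRate i := fun i => div_nonneg (hq i) (hS i)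
  have n2 : ∀ i, 0 ≤ q i / umax := fun i => div_nonneg (hq i) humax.le
  have s1 := fun i => Finset.single_le_sum (fun i _ => n1 i) (Finset.mem_univ i)
  have s2 := fun i => Finset.single_le_sum (fun i _ => n2 i) (Finset.mem_univ i)
  have s3 := fun k => Finset.single_le_sum (fun i _ => hv i) (Finset.mem_univ k)
  have t1 : 0 ≤ ∑ i, q i / net.serviceRate i := Finset.sum_nonneg fun i _ => n1 i
  have t2 : 0 ≤ ∑ i, q i / umax := Finset.sum_nonneg fun i _ => n2 i
  have t3 : 0 ≤ ∑ k, v k := Finset.sum_nonneg fun i _ => hv i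
  have hC0 : 0 ≤ C := by positivity
  refine ⟨fun i => C * (h i + 1), fun i => by positivity, fun i => ?_⟩
  set z : Fin n → ℝ := fun i => C * (h i + 1) with hz
  have hz0 : 0 ≤ z i := by positivity
  have hterm : ∀ k, (if net.src k = i then min 0 (net.routeGain v z k) else 0) ≤ 0 := fun k => by
    split_ifs
    · exact min_le_left _ _
    · rfl
  rcases hh i with hi | ⟨k, hk, hlt⟩
  · have h1 : q i ≤ net.serviceRate i * z i := by
      have h2 : q i / net.serviceRate i ≤ z i := by
        have : C * 1 ≤ C * ((h i : ℝ) + 1) := by gcongr; linarith [(h i).cast_nonneg (α := ℝ)]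
        have := s1 i
        simp only [hz]; linarith
      rwa [div_le_iff₀' hi] at h2
    have h2 := mul_nonpos_of_nonneg_of_nonpos humax.le
      (Finset.sum_nonpos fun k (_ : k ∈ Finset.univ) => hterm k)
    linarith
  · have h1 : ∑ k, (if net.src k = i then min 0 (net.routeGain v z k) else 0) ≤
        net.routeGain v z k := by
      rw [← neg_le_neg_iff, ← Finset.sum_neg_distrib]
      refine le_trans ?_ (Finset.single_le_sum
        (fun k _ => neg_nonneg.2 (hterm k)) (Finset.mem_univ k))
      rw [if_pos hk]; exact neg_le_neg (min_le_right _ _)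
    have h2 : net.routeGain v z k ≤ -(q i / umax) := by
      have h3 : (h (net.dst k) : ℝ) + 1 ≤ h i := by exact_mod_cast hlt
      have h4 := mul_le_mul_of_nonneg_left h3 hC0
      have := s2 i; have := s3 k
      simp only [routeGain, hk, hz]
      linarith
    have h3 := mul_le_mul_of_nonneg_left (h1.trans h2) humax.le
    have h4 : umax * -(q i / umax) = -q i := by field_simp
    have := mul_nonneg (hS i) hz0
    linarith

/-- One step of value iteration. -/
noncomputable def valueStep (umax : ℝ) (q : Fin n → ℝ) (v : Fin mD → ℝ) (y : Fin n → ℝ)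
    (i : Fin n) : ℝ :=
  (q i + umax * ∑ k, (if net.src k = i then min (y i) (y (net.dst k) + v k) else 0)) /
    (net.serviceRate i + umax * ∑ k, (if net.src k = i then 1 else 0))

lemma valueStep_den_pos (hreach : net.EveryQueueReachesExit) (humax : 0 < umax) (i : Fin n) :
    0 < net.serviceRate i + umax * ∑ k, (if net.src k = i then (1 : ℝ) else 0) := by
  have h0 : ∀ k, 0 ≤ (if net.src k = i then (1 : ℝ) else 0) := fun k => by split_ifs <;> simp
  obtain ⟨h, hh⟩ := net.exists_rank hreach
  rcases hh i with hi | ⟨k, hk, -⟩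
  · have := mul_nonneg humax.le (Finset.sum_nonneg fun k (_ : k ∈ Finset.univ) => h0 k)
    linarith
  · have h1 := Finset.single_le_sum (fun k _ => h0 k) (Finset.mem_univ k)
    rw [if_pos hk] at h1
    have := mul_pos humax (zero_lt_one.trans_le h1)
    have := net.serviceRate_nonneg i
    linarith

/-- The residual of the algebraic equation is a positive multiple of the displacement under
`valueStep`: fixed points are solutions, and supersolutions are mapped below themselves. Moving the
`y i` of each gain into the denominator is what makes the step monotone. -/
lemma valueStep_sub (y : Fin n → ℝ) (q : Fin n → ℝ) (v : Fin mD → ℝ) (i : Fin n)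
    (hd : 0 < net.serviceRate i + umax * ∑ k, (if net.src k = i then (1 : ℝ) else 0)) :
    (net.valueStep umax q v y i - y i) *
      (net.serviceRate i + umax * ∑ k, (if net.src k = i then (1 : ℝ) else 0)) =
    q i - net.serviceRate i * y i +
      umax * ∑ k, (if net.src k = i then min 0 (net.routeGain v y k) else 0) := by
  have h : ∑ k, (if net.src k = i then min 0 (net.routeGain v y k) else 0) =
      ∑ k, (if net.src k = i then min (y i) (y (net.dst k) + v k) else 0) -
        y i * ∑ k, (if net.src k = i then (1 : ℝ) else 0) := by
    rw [Finset.mul_sum, ← Finset.sum_sub_distrib]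
    refine Finset.sum_congr rfl fun k _ => ?_
    split_ifs with hk
    · rw [routeGain, hk, mul_one, ← min_sub_sub_right, sub_self]; congr 1; ring
    · simp
  rw [h, sub_mul, valueStep, div_mul_cancel₀ _ hd.ne']
  ring

lemma valueStep_mono (hreach : net.EveryQueueReachesExit) (humax : 0 < umax) (q : Fin n → ℝ)
    (v : Fin mD → ℝ) : Monotone (net.valueStep umax q v) := by
  intro a b hab i
  refine div_le_div_of_nonneg_right ?_ (net.valueStep_den_pos hreach humax i).le
  gcongr with k
  split_ifs
  · exact min_le_min (hab i) (by linarith [hab (net.dst k)])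
  · rfl

/-- Knaster–Tarski on an order interval whose upper end already encodes the normalization. -/
theorem exists_normalized_solution (hreach : net.EveryQueueReachesExit) (humax : 0 < umax)
    {q : Fin n → ℝ} (hq : ∀ i, 0 ≤ q i) {v : Fin mD → ℝ} (hv : ∀ k, 0 ≤ v k) :
    ∃ y : Fin n → ℝ, net.SolvesAlgebraicEq umax q v y ∧ ∀ i, q i = 0 → y i = 0 := by
  classical
  have hd := net.valueStep_den_pos hreach humax
  have hmono := net.valueStep_mono hreach humax q v
  obtain ⟨z, hz0, hz⟩ := net.exists_supersolution hreach humax hq hv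
  have hTz : net.valueStep umax q v z ≤ z := fun i => by
    have h := net.valueStep_sub z q v i (hd i)
    have := nonpos_of_mul_nonpos_left (h.trans_le (hz i)) (hd i)
    linarith
  -- Cutting the supersolution to zero where `q i = 0` keeps the interval invariant: there `y i = 0`
  -- and `y (dst k) + v k ≥ 0`, so every minimum in `valueStep` is zero.
  let b : Fin n → ℝ := fun i => if q i = 0 then 0 else z i
  have hb0 : 0 ≤ b := fun i => by simp only [b]; split_ifs <;> simp [hz0 i]
  have hbz : b ≤ z := fun i => by simp only [b]; split_ifs <;> simp [hz0 i]
  have hmaps : ∀ y ∈ Set.Icc 0 b, net.valueStep umax q v y ∈ Set.Icc 0 b := by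
    intro y hy
    have hy0 : ∀ k, 0 ≤ y (net.dst k) + v k := fun k => add_nonneg (hy.1 _) (hv k)
    constructor
    · intro i
      refine div_nonneg (add_nonneg (hq i) (mul_nonneg humax.le (Finset.sum_nonneg fun k _ => ?_)))
        (hd i).le
      split_ifs
      · exact le_min (hy.1 i) (hy0 k)
      · rfl
    · intro i
      by_cases hi : q i = 0
      · have hyi : y i = 0 := le_antisymm (by simpa [b, hi] using hy.2 i) (hy.1 i)
        have : net.valueStep umax q v y i = 0 := by
          simp [valueStep, hi, hyi, min_eq_left (hy0 _)]
        rw [this]; exact hb0 i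
      · simpa [b, hi] using (hmono (hy.2.trans hbz) i).trans (hTz i)
  -- Makes `Set.Icc 0 b` a complete lattice, as `OrderHom.lfp` requires.
  have : Fact ((0 : Fin n → ℝ) ≤ b) := ⟨hb0⟩
  let T : Set.Icc 0 b →o Set.Icc 0 b :=
    ⟨fun y => ⟨net.valueStep umax q v y, hmaps y y.2⟩, fun _ _ h => hmono h⟩
  have hfix : net.valueStep umax q v (OrderHom.lfp T).1 = (OrderHom.lfp T).1 :=
    congrArg Subtype.val T.map_lfp
  refine ⟨(OrderHom.lfp T).1, (net.solvesAlgebraicEq_iff q v _).2 fun i => ?_, fun i hi => ?_⟩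
  · rw [← net.valueStep_sub _ q v i (hd i), hfix, sub_self, zero_mul]
  · exact le_antisymm (by simpa [b, hi] using (OrderHom.lfp T).2.2 i) ((OrderHom.lfp T).2.1 i)

end QueueNetwork

namespace QueueNetwork

variable {n mE mD : ℕ} (net : QueueNetwork n mE mD) {umax : ℝ}

/-! ### The law lives on the states with at most as many units as the initial state -/

/-- Truncation discards only mass above level `N`, which can act on a state of the level solely as
inflow. -/
lemma levGen_le_masterRHS (U : FeedbackPolicy n mD umax) {p : QState n → ℝ} (hp : ∀ x, 0 ≤ p x)
    {N : ℕ} (s : Lev n N) :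
    net.levGen U N (fun s => p s.1) s ≤ net.masterRHS U p s.1 := by
  set f : QState n → ℝ := ext0 fun s : Lev n N => p s.1 with hf
  have hg : ∀ x, 0 ≤ (p - f) x := fun x => by
    simp only [Pi.sub_apply, hf, ext0]; split_ifs <;> simp [hp x]
  have hs : (p - f) s.1 = 0 := by simp [hf, ext0, s.2]
  have hsplit := net.masterRHS_add U f (p - f) s.1
  rw [add_sub_cancel] at hsplit
  rw [hsplit, levGen_apply, le_add_iff_nonneg_right]
  simp only [masterRHS, hs, mul_zero, sub_zero]
  exact add_nonneg
    (Finset.sum_nonneg fun j _ => inflow_nonneg _ _ _ (net.exitEventRate_nonneg j) hg _)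
    (Finset.sum_nonneg fun k _ => inflow_nonneg _ _ _ (net.routeEventRate_nonneg U k) hg _)

lemma hasDerivAt_of_mem_Ici {f : ℝ → ℝ} {f' t : ℝ} (h : HasDerivWithinAt f f' (Set.Ici 0) t)
    (ht : 0 < t) : HasDerivAt f f' t :=
  h.hasDerivAt (Ici_mem_nhds ht)

variable {net} {U : FeedbackPolicy n mD umax} {x₀ : QState n} {P : ℝ → PMF (QState n)}

/-- The mass of the level starts at one and cannot decrease, since the truncated generator conserves
mass and bounds the true derivative from below. The argument covers every solution of the master
equation, so uniqueness is not needed. -/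
lemma IsMasterSolution.sum_lev (hP : net.IsMasterSolution U x₀ P) {t : ℝ} (ht : 0 ≤ t) :
    ∑ s : Lev n (∑ i, x₀ i), (P t s.1).toReal = 1 := by
  classical
  set N := ∑ i, x₀ i with hN
  have hd : ∀ t, 0 ≤ t → HasDerivWithinAt (fun t => ∑ s : Lev n N, (P t s.1).toReal)
      (∑ s : Lev n N, net.masterRHS U (fun z => (P t z).toReal) s.1) (Set.Ici 0) t :=
    fun t ht => HasDerivWithinAt.fun_sum fun s _ => hP.deriv t ht s.1
  have hmono : MonotoneOn (fun t => ∑ s : Lev n N, (P t s.1).toReal) (Set.Ici 0) := by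
    refine monotoneOn_of_deriv_nonneg (convex_Ici 0)
      (fun t ht => (hd t ht).continuousWithinAt) ?_ ?_
    · rw [interior_Ici]
      exact fun t ht =>
        (hasDerivAt_of_mem_Ici (hd t ht.le) ht).differentiableAt.differentiableWithinAt
    · rw [interior_Ici]
      intro t ht
      rw [(hasDerivAt_of_mem_Ici (hd t (le_of_lt ht)) ht).deriv,
        ← net.sum_levGen U N fun s => (P t s.1).toReal]
      exact Finset.sum_le_sum fun s _ =>
        net.levGen_le_masterRHS U (fun x => ENNReal.toReal_nonneg) s
  have h0 : ∑ s : Lev n N, (P 0 s.1).toReal = 1 := by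
    rw [hP.init, Finset.sum_eq_single (⟨x₀, le_rfl⟩ : Lev n N)]
    · simp
    · intro s _ hs
      have : s.1 ≠ x₀ := fun h => hs (Subtype.ext h)
      simp [PMF.pure_apply, this]
    · simp
  refine le_antisymm ?_ (h0 ▸ hmono Set.self_mem_Ici ht ht)
  rw [← ENNReal.toReal_sum fun s _ => (P t).apply_ne_top s.1]
  refine ENNReal.toReal_le_of_le_ofReal zero_le_one ?_
  rw [ENNReal.ofReal_one, ← (P t).tsum_coe, ← tsum_fintype (L := .unconditional _)]
  exact ENNReal.tsum_comp_le_tsum_of_injective Subtype.val_injective _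

lemma IsMasterSolution.eq_ext0 (hP : net.IsMasterSolution U x₀ P) {t : ℝ} (ht : 0 ≤ t) :
    (fun x => (P t x).toReal) = ext0 fun s : Lev n (∑ i, x₀ i) => (P t s.1).toReal := by
  classical
  set N := ∑ i, x₀ i with hN
  funext x
  by_cases hx : ∑ i, x i ≤ N
  · simp [ext0, hx]
  · have hsum : ∑ s : Lev n N, P t s.1 = 1 := by
      rw [← ENNReal.toReal_eq_one_iff, ENNReal.toReal_sum fun s _ => (P t).apply_ne_top s.1]
      exact hP.sum_lev ht
    let F : Finset (QState n) := Finset.univ.map (Function.Embedding.subtype fun x : QState n =>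
      ∑ i, x i ≤ N)
    have hF : ∑ x ∈ F, P t x = 1 := by rw [Finset.sum_map]; exact hsum
    have hxF : x ∉ F := by simp [F, hx]
    have h1 : ∑ x ∈ insert x F, P t x ≤ 1 := (P t).tsum_coe ▸ ENNReal.sum_le_tsum _
    rw [Finset.sum_insert hxF, hF] at h1
    have h2 : P t x = 0 := by
      by_contra h
      exact absurd h1 (not_le.2 (by
        rw [add_comm]; exact ENNReal.lt_add_right ENNReal.one_ne_top h))
    simp [ext0, hx, h2]

/-! ### Expectations and Dynkin's formula for linear functions -/

/-- Expectation of `f (X t)` under the law `P`, for a network started with `N` units. -/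
noncomputable def expect (N : ℕ) (P : ℝ → PMF (QState n)) (f : QState n → ℝ) (t : ℝ) : ℝ :=
  ∑ s : Lev n N, (P t s.1).toReal * f s.1

lemma expect_add (N : ℕ) (f g : QState n → ℝ) (t : ℝ) :
    expect N P (fun x => f x + g x) t = expect N P f t + expect N P g t := by
  simp [expect, mul_add, Finset.sum_add_distrib]

lemma expect_const_mul (N : ℕ) (c : ℝ) (f : QState n → ℝ) (t : ℝ) :
    expect N P (fun x => c * f x) t = c * expect N P f t := by
  simp only [expect, Finset.mul_sum]
  exact Finset.sum_congr rfl fun _ _ => by ring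

lemma expect_mono (N : ℕ) {f g : QState n → ℝ} (h : ∀ x, f x ≤ g x) (t : ℝ) :
    expect N P f t ≤ expect N P g t :=
  Finset.sum_le_sum fun s _ => mul_le_mul_of_nonneg_left (h s.1) ENNReal.toReal_nonneg

lemma expect_nonneg (N : ℕ) {f : QState n → ℝ} (h : ∀ x, 0 ≤ f x) (t : ℝ) :
    0 ≤ expect N P f t :=
  Finset.sum_nonneg fun s _ => mul_nonneg ENNReal.toReal_nonneg (h s.1)

/-- The value of the linear function with coefficients `y` in state `x`. -/
noncomputable def linValue (y : Fin n → ℝ) (x : QState n) : ℝ := y ⬝ᵥ fun i => (x i : ℝ)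

/-- The generator of the network applied to the linear function with coefficients `y`. -/
noncomputable def drift (net : QueueNetwork n mE mD) (U : FeedbackPolicy n mD umax)
    (y : Fin n → ℝ) (x : QState n) : ℝ :=
  ∑ j, net.exitEventRate j x * -y (net.exitQueue j) +
    ∑ k, net.routeEventRate U k x * (y (net.dst k) - y (net.src k))

/-- A jump by `r` changes a linear function by the constant `y ⬝ᵥ r`, so re-indexing by the
departure state reduces everything to `sum_inflow`. -/
lemma sum_inflow_mul_linValue (r : Fin n → ℤ) (W : QState n → ℝ) (hr : ∑ l, r l ≤ 0)
    (hW : ∀ x, W x ≠ 0 → ∀ l, 0 ≤ (x l : ℤ) + r l) {N : ℕ} (p : Lev n N → ℝ) (y : Fin n → ℝ) :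
    ∑ s : Lev n N, inflow r W (ext0 p) s.1 * linValue y s.1 =
      ∑ s : Lev n N, (W s.1 * p s) * (linValue y s.1 + y ⬝ᵥ fun l => (r l : ℝ)) := by
  have h1 : ∀ x, inflow r W (ext0 p) x * linValue y x =
      inflow r (fun x => W x * linValue y x) (ext0 p) x +
        inflow r W (ext0 p) x * y ⬝ᵥ fun l => (r l : ℝ) := by
    intro x
    unfold inflow
    split_ifs with h
    · have h2 : linValue y x = linValue y (fun l => ((x l : ℤ) - r l).toNat) +
          y ⬝ᵥ fun l => (r l : ℝ) := by
        rw [linValue, linValue, ← dotProduct_add]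
        congr 1
        funext l
        have h3 : ((((x l : ℤ) - r l).toNat : ℤ) : ℝ) = (((x l : ℤ) - r l : ℤ) : ℝ) := by
          rw [Int.toNat_of_nonneg (h l)]
        rw [Pi.add_apply, ← Int.cast_natCast (((x l : ℤ) - r l).toNat), h3]
        push_cast
        ring
      rw [h2]; ring
    · simp
  have hext : ∀ s : Lev n N, ext0 p s.1 = p s := fun s => by simp [ext0, s.2]
  simp only [h1, Finset.sum_add_distrib, ← Finset.sum_mul]
  rw [sum_inflow r _ hr (fun x hx => hW x (left_ne_zero_of_mul hx)), sum_inflow r W hr hW,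
    Finset.sum_mul, ← Finset.sum_add_distrib]
  refine Finset.sum_congr rfl fun s _ => ?_
  rw [hext]; ring

lemma sum_levGen_mul_linValue (net : QueueNetwork n mE mD) (U : FeedbackPolicy n mD umax) (N : ℕ)
    (p : Lev n N → ℝ) (y : Fin n → ℝ) :
    ∑ s, net.levGen U N p s * linValue y s.1 = ∑ s, p s * net.drift U y s.1 := by
  have hE : ∀ j, (y ⬝ᵥ fun l => (net.exitJump j l : ℝ)) = -y (net.exitQueue j) := fun j => by
    simp [dotProduct, exitJump, Pi.single_apply]
  have hD : ∀ k, (y ⬝ᵥ fun l => (net.routeJump k l : ℝ)) = y (net.dst k) - y (net.src k) :=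
    fun k => by simp [dotProduct, routeJump, Pi.single_apply, mul_sub, Finset.sum_sub_distrib]
  have hext : ∀ s : Lev n N, ext0 p s.1 = p s := fun s => by simp [ext0, s.2]
  simp only [levGen_apply, masterRHS, add_mul, Finset.sum_mul, sub_mul, Finset.sum_add_distrib]
  rw [Finset.sum_comm, Finset.sum_comm (s := (Finset.univ : Finset (Lev n N)))
    (t := (Finset.univ : Finset (Fin mD)))]
  simp only [Finset.sum_sub_distrib]
  simp only [sum_inflow_mul_linValue _ _ (net.sum_exitJump _) (net.exit_feasible _),
    sum_inflow_mul_linValue _ _ (net.sum_routeJump _) (net.route_feasible U _), hE, hD, hext,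
    drift, mul_add, Finset.sum_add_distrib, Finset.mul_sum]
  -- The outflow cancels the value at the departure state; only the increments remain.
  rw [add_sub_cancel_left, add_sub_cancel_left,
    Finset.sum_comm (s := (Finset.univ : Finset (Fin mE))),
    Finset.sum_comm (s := (Finset.univ : Finset (Fin mD)))]
  congr 1 <;> exact Finset.sum_congr rfl fun s _ => Finset.sum_congr rfl fun _ _ => by ring

lemma IsMasterSolution.hasDerivWithinAt_expect (hP : net.IsMasterSolution U x₀ P)
    (y : Fin n → ℝ) {t : ℝ} (ht : 0 ≤ t) :
    HasDerivWithinAt (expect (∑ i, x₀ i) P (linValue y))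
      (expect (∑ i, x₀ i) P (net.drift U y) t) (Set.Ici 0) t := by
  have h := HasDerivWithinAt.fun_sum (u := Finset.univ)
    fun (s : Lev n (∑ i, x₀ i)) _ => (hP.deriv t ht s.1).mul_const (linValue y s.1)
  rw [hP.eq_ext0 ht] at h
  exact h.congr_deriv (sum_levGen_mul_linValue net U _ _ y)

lemma IsMasterSolution.continuousOn_expect (hP : net.IsMasterSolution U x₀ P) (N : ℕ)
    (f : QState n → ℝ) : ContinuousOn (expect N P f) (Set.Ici 0) :=
  continuousOn_finsetSum _ fun s _ =>
    ContinuousOn.mul (fun t ht => (hP.deriv t ht s.1).continuousWithinAt) continuousOn_const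

lemma IsMasterSolution.intervalIntegrable_expect (hP : net.IsMasterSolution U x₀ P) (N : ℕ)
    (f : QState n → ℝ) {T : ℝ} (hT : 0 ≤ T) :
    IntervalIntegrable (expect N P f) volume 0 T := by
  refine ContinuousOn.intervalIntegrable ?_
  rw [Set.uIcc_of_le hT]
  exact (hP.continuousOn_expect N f).mono Set.Icc_subset_Ici_self

lemma IsMasterSolution.expect_zero (hP : net.IsMasterSolution U x₀ P) (f : QState n → ℝ) :
    expect (∑ i, x₀ i) P f 0 = f x₀ := by
  classical
  rw [expect, hP.init, Finset.sum_eq_single (⟨x₀, le_rfl⟩ : Lev n (∑ i, x₀ i))]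
  · simp
  · intro s _ hs
    have : s.1 ≠ x₀ := fun h => hs (Subtype.ext h)
    simp [PMF.pure_apply, this]
  · simp

/-- The expectation is a finite sum of differentiable functions, so this is the fundamental theorem
of calculus. -/
theorem IsMasterSolution.dynkin (hP : net.IsMasterSolution U x₀ P) (y : Fin n → ℝ) {T : ℝ}
    (hT : 0 ≤ T) :
    ∫ t in (0 : ℝ)..T, expect (∑ i, x₀ i) P (net.drift U y) t =
      expect (∑ i, x₀ i) P (linValue y) T - linValue y x₀ := by
  rw [← hP.expect_zero (linValue y)]
  refine intervalIntegral.integral_eq_sub_of_hasDerivAt_of_le hT ?_ ?_ ?_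
  · exact (hP.continuousOn_expect _ _).mono Set.Icc_subset_Ici_self
  · exact fun t ht => hasDerivAt_of_mem_Ici (hP.hasDerivWithinAt_expect y ht.1.le) ht.1
  · exact hP.intervalIntegrable_expect _ _ hT

lemma IsMasterSolution.lintegral_eq (hP : net.IsMasterSolution U x₀ P) {f : QState n → ℝ}
    (hf : ∀ x, 0 ≤ f x) {t : ℝ} (ht : 0 ≤ t) :
    ∫⁻ x, ENNReal.ofReal (f x) ∂(P t).toMeasure =
      ENNReal.ofReal (expect (∑ i, x₀ i) P f t) := by
  classical
  set N := ∑ i, x₀ i with hN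
  have hx : ∀ x, ¬ ∑ i, x i ≤ N → P t x = 0 := fun x hx => by
    have : (P t x).toReal = 0 := (congrFun (hP.eq_ext0 ht) x).trans (dif_neg hx)
    exact ((ENNReal.toReal_eq_zero_iff _).1 this).resolve_right ((P t).apply_ne_top x)
  have hterm : ∀ x, ENNReal.ofReal (f x) * (P t).toMeasure {x} =
      ENNReal.ofReal ((P t x).toReal * f x) := fun x => by
    rw [PMF.toMeasure_apply_singleton _ _ (measurableSet_singleton x), mul_comm,
      ENNReal.ofReal_mul ENNReal.toReal_nonneg, ENNReal.ofReal_toReal ((P t).apply_ne_top x)]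
  rw [lintegral_countable']
  simp only [hterm]
  rw [expect, ENNReal.ofReal_sum_of_nonneg fun s _ => mul_nonneg ENNReal.toReal_nonneg (hf s.1),
    ← tsum_fintype (L := .unconditional _)]
  refine (tsum_subtype_eq_of_support_subset (s := {x : QState n | ∑ i, x i ≤ N})
    (f := fun x => ENNReal.ofReal ((P t x).toReal * f x)) fun x h => ?_).symm
  by_contra h'
  exact h (by simp [hx x h'])

end QueueNetwork

namespace QueueNetwork

variable {n mE mD : ℕ} (net : QueueNetwork n mE mD) {umax : ℝ}

/-! ### Verification of the value function -/

lemma sum_ite_src_mul (w : Fin mD → ℝ) (z : Fin n → ℝ) :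
    ∑ i, (∑ k, if net.src k = i then w k else 0) * z i = ∑ k, w k * z (net.src k) := by
  simp only [Finset.sum_mul]
  rw [Finset.sum_comm]
  simp [ite_mul]

lemma sum_serviceRate_mul (z : Fin n → ℝ) :
    ∑ i, net.serviceRate i * z i = ∑ j, net.exitRate j * z (net.exitQueue j) := by
  simp only [serviceRate, Finset.sum_mul]
  rw [Finset.sum_comm]
  simp [ite_mul]

lemma stageCost_mat (q : Fin n → ℝ) (v : Fin mD → ℝ) (U : FeedbackPolicy n mD umax)
    (x : QState n) : net.stageCost q v x (U.mat x) =
      linValue q x + ∑ k, v k * net.routeEventRate U k x := by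
  have hH : (net.H *ᵥ fun i => (x i : ℝ)) = fun k => (x (net.src k) : ℝ) := by
    funext k; simp [H, Matrix.mulVec, dotProduct]
  rw [stageCost, hH, FeedbackPolicy.mat, linValue]
  simp [dotProduct, Matrix.mulVec_diagonal, routeEventRate]

lemma linValue_nonneg {y : Fin n → ℝ} (hy : ∀ i, 0 ≤ y i) (x : QState n) : 0 ≤ linValue y x := by
  rw [linValue, dotProduct]
  exact Finset.sum_nonneg fun i _ => mul_nonneg (hy i) (Nat.cast_nonneg _)

lemma linValue_le_stageCost (q : Fin n → ℝ) {v : Fin mD → ℝ} (hv : ∀ k, 0 ≤ v k)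
    (U : FeedbackPolicy n mD umax) (x : QState n) :
    linValue q x ≤ net.stageCost q v x (U.mat x) := by
  rw [stageCost_mat, le_add_iff_nonneg_right]
  exact Finset.sum_nonneg fun k _ => mul_nonneg (hv k) (net.routeEventRate_nonneg U k x)

lemma stageCost_nonneg {q : Fin n → ℝ} (hq : ∀ i, 0 ≤ q i) {v : Fin mD → ℝ} (hv : ∀ k, 0 ≤ v k)
    (U : FeedbackPolicy n mD umax) (x : QState n) : 0 ≤ net.stageCost q v x (U.mat x) :=
  (linValue_nonneg hq x).trans (net.linValue_le_stageCost q hv U x)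

/-- The total number of units decreases at the total exit rate. -/
lemma drift_one (U : FeedbackPolicy n mD umax) (x : QState n) :
    net.drift U (fun _ => 1) x = -1 * linValue net.serviceRate x := by
  have h := net.sum_serviceRate_mul fun i => (x i : ℝ)
  simp only [drift, exitEventRate, linValue, dotProduct, h]
  simp

/-- The Bellman residual of a solution of the algebraic equation. -/
lemma drift_add_stageCost {q : Fin n → ℝ} {v : Fin mD → ℝ} {y : Fin n → ℝ}
    (hy : net.SolvesAlgebraicEq umax q v y) (U : FeedbackPolicy n mD umax) (x : QState n) :
    net.drift U y x + net.stageCost q v x (U.mat x) =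
      ∑ k, ((U x k : ℝ) * net.routeGain v y k - umax * min 0 (net.routeGain v y k)) *
        x (net.src k) := by
  -- The algebraic equation weighted by `x i` and summed; it eliminates `q` and the exit terms from
  -- the residual.
  have h0 : ∑ i, (q i - net.serviceRate i * y i + umax * ∑ k,
      (if net.src k = i then min 0 (net.routeGain v y k) else 0)) * (x i : ℝ) = 0 :=
    Finset.sum_eq_zero fun i _ => by
      rw [(net.solvesAlgebraicEq_iff q v y).1 hy i, zero_mul]
  have h1 := net.sum_ite_src_mul (fun k => min 0 (net.routeGain v y k)) fun i => (x i : ℝ)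
  have h2 := net.sum_serviceRate_mul fun i => y i * (x i : ℝ)
  simp only [add_mul, sub_mul, Finset.sum_add_distrib, Finset.sum_sub_distrib, mul_assoc,
    ← Finset.mul_sum, h1, h2] at h0
  have h3 : ∑ j, net.exitEventRate j x * -y (net.exitQueue j) =
      -∑ j, net.exitRate j * (y (net.exitQueue j) * (x (net.exitQueue j) : ℝ)) := by
    rw [← Finset.sum_neg_distrib]
    exact Finset.sum_congr rfl fun j _ => by rw [exitEventRate]; ring
  have h4 : ∑ k, net.routeEventRate U k x * (y (net.dst k) - y (net.src k)) +
      ∑ k, v k * net.routeEventRate U k x =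
      ∑ k, (U x k : ℝ) * net.routeGain v y k * x (net.src k) := by
    rw [← Finset.sum_add_distrib]
    exact Finset.sum_congr rfl fun k _ => by rw [routeEventRate, routeGain]; ring
  rw [stageCost_mat, drift, h3]
  simp only [sub_mul, Finset.sum_sub_distrib, mul_assoc, ← Finset.mul_sum] at h4 ⊢
  rw [← h4]
  simp only [linValue, dotProduct]
  linarith

lemma mul_min_zero_le {u c : ℝ} (hu : u ∈ Set.Icc 0 umax) : umax * min 0 c ≤ u * c := by
  rcases le_total 0 c with h | h
  · rw [min_eq_left h, mul_zero]; exact mul_nonneg hu.1 h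
  · rw [min_eq_right h]; exact mul_le_mul_of_nonpos_right hu.2 h

lemma drift_add_stageCost_nonneg {q : Fin n → ℝ} {v : Fin mD → ℝ} {y : Fin n → ℝ}
    (hy : net.SolvesAlgebraicEq umax q v y) (U : FeedbackPolicy n mD umax) (x : QState n) :
    0 ≤ net.drift U y x + net.stageCost q v x (U.mat x) := by
  rw [net.drift_add_stageCost hy]
  exact Finset.sum_nonneg fun k _ =>
    mul_nonneg (sub_nonneg.2 (mul_min_zero_le (U x k).2)) (Nat.cast_nonneg _)

/-- Negative gain selects `umax`, positive gain selects `0`; at zero gain the term vanishes for any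
control, so the choice of `θ` is immaterial. -/
lemma drift_add_stageCost_bangBang {q : Fin n → ℝ} {v : Fin mD → ℝ} {y : Fin n → ℝ}
    (hy : net.SolvesAlgebraicEq umax q v y) (humax : 0 ≤ umax) {θ : ℝ}
    (hθ : θ ∈ Set.Icc (-1 : ℝ) 1) (x : QState n) :
    net.drift (net.bangBang humax hθ v y) y x +
      net.stageCost q v x ((net.bangBang humax hθ v y).mat x) = 0 := by
  rw [net.drift_add_stageCost hy]
  refine Finset.sum_eq_zero fun k _ => ?_
  have hc : (y ᵥ* net.RD + v) k = net.routeGain v y k := by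
    rw [Pi.add_apply, vecMul_RD, routeGain]
  simp only [bangBang, hc, sgn]
  rcases lt_trichotomy (net.routeGain v y k) 0 with h | h | h
  · rw [if_neg h.not_gt, if_pos h, min_eq_right h.le]; ring
  · simp [h]
  · rw [if_pos h, min_eq_left h.le]; ring

/-! ### Cost bounds from Dynkin's formula -/

lemma costUpTo_eq {q : Fin n → ℝ} (hq : ∀ i, 0 ≤ q i) {v : Fin mD → ℝ} (hv : ∀ k, 0 ≤ v k)
    (U : FeedbackPolicy n mD umax) (x₀ : QState n) {T : ℝ} (hT : 0 ≤ T) :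
    net.costUpTo q v U x₀ T = ENNReal.ofReal (∫ t in (0 : ℝ)..T,
      expect (∑ i, x₀ i) (net.law U x₀) (fun x => net.stageCost q v x (U.mat x)) t) := by
  have hP := net.law_spec U x₀
  have hg := net.stageCost_nonneg hq hv U
  rw [intervalIntegral.integral_of_le hT, ← integral_Icc_eq_integral_Ioc,
    ofReal_integral_eq_lintegral_ofReal]
  · exact setLIntegral_congr_fun measurableSet_Icc fun t ht => hP.lintegral_eq hg ht.1
  · exact ((hP.continuousOn_expect _ _).mono Set.Icc_subset_Ici_self).integrableOn_Icc
  · exact ae_of_all _ fun t => expect_nonneg _ hg t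

lemma costUpTo_le_cost (q : Fin n → ℝ) (v : Fin mD → ℝ) (U : FeedbackPolicy n mD umax)
    (x₀ : QState n) (T : ℝ) : net.costUpTo q v U x₀ T ≤ net.cost q v U x₀ :=
  Monotone.ge_of_tendsto (fun _ _ h => lintegral_mono_set (Set.Icc_subset_Icc_right h))
    (net.tendsto_costUpTo q v U x₀) T

/-- Valid for any `y` and any policy; the sign of the integrated Bellman residual then yields both
the lower and the upper bound on the cost. -/
lemma linValue_sub_expect_eq {q : Fin n → ℝ} {v : Fin mD → ℝ} (y : Fin n → ℝ)
    (U : FeedbackPolicy n mD umax) (x₀ : QState n) {T : ℝ} (hT : 0 ≤ T) :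
    linValue y x₀ - expect (∑ i, x₀ i) (net.law U x₀) (linValue y) T +
      ∫ t in (0 : ℝ)..T, expect (∑ i, x₀ i) (net.law U x₀)
        (fun x => net.drift U y x + net.stageCost q v x (U.mat x)) t =
    ∫ t in (0 : ℝ)..T,
      expect (∑ i, x₀ i) (net.law U x₀) (fun x => net.stageCost q v x (U.mat x)) t := by
  have hP := net.law_spec U x₀
  simp only [expect_add]
  rw [intervalIntegral.integral_add (hP.intervalIntegrable_expect _ _ hT)
    (hP.intervalIntegrable_expect _ _ hT), hP.dynkin y hT]
  ring

lemma ofReal_sub_expect_le_cost {q : Fin n → ℝ} (hq : ∀ i, 0 ≤ q i) {v : Fin mD → ℝ}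
    (hv : ∀ k, 0 ≤ v k) {y : Fin n → ℝ} (hy : net.SolvesAlgebraicEq umax q v y)
    (U : FeedbackPolicy n mD umax) (x₀ : QState n) {T : ℝ} (hT : 0 ≤ T) :
    ENNReal.ofReal (linValue y x₀ - expect (∑ i, x₀ i) (net.law U x₀) (linValue y) T) ≤
      net.cost q v U x₀ := by
  refine le_trans (ENNReal.ofReal_le_ofReal ?_)
    ((net.costUpTo_eq hq hv U x₀ hT).symm.le.trans (net.costUpTo_le_cost q v U x₀ T))
  rw [← net.linValue_sub_expect_eq y U x₀ hT, le_add_iff_nonneg_right]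
  exact intervalIntegral.integral_nonneg hT fun t _ =>
    expect_nonneg _ (net.drift_add_stageCost_nonneg hy U) t

/-- If the cost is finite, the expected value gets arbitrarily small. -/
lemma exists_expect_lt {q : Fin n → ℝ} (hq : ∀ i, 0 ≤ q i) {v : Fin mD → ℝ} (hv : ∀ k, 0 ≤ v k)
    {y : Fin n → ℝ} (hnorm : ∀ i, q i = 0 → net.serviceRate i = 0 → y i = 0)
    (U : FeedbackPolicy n mD umax) (x₀ : QState n) (hfin : net.cost q v U x₀ ≠ ⊤) {ε : ℝ}
    (hε : 0 < ε) : ∃ T, 0 ≤ T ∧ expect (∑ i, x₀ i) (net.law U x₀) (linValue y) T < ε := by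
  by_contra! hlarge
  have hP := net.law_spec U x₀
  have hS := net.serviceRate_nonneg
  -- The normalization enters here: where `q i` and the service rate both vanish, so must `y i`.
  obtain ⟨κ, hκ0, hκ⟩ : ∃ κ : ℝ, 0 ≤ κ ∧ ∀ i, y i ≤ κ * (q i + net.serviceRate i) := by
    refine ⟨∑ i, |y i| / (q i + net.serviceRate i), Finset.sum_nonneg fun i _ =>
      div_nonneg (abs_nonneg _) (add_nonneg (hq i) (hS i)), fun i => ?_⟩
    rcases (add_nonneg (hq i) (hS i)).eq_or_lt with h | h
    · have h1 : q i = 0 := by linarith [hq i, hS i]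
      have h2 : net.serviceRate i = 0 := by linarith [hq i, hS i]
      simp [hnorm i h1 h2, h1, h2]
    · rw [← div_le_iff₀ h]
      refine (div_le_div_of_nonneg_right (le_abs_self _) h.le).trans ?_
      exact Finset.single_le_sum (f := fun i => |y i| / (q i + net.serviceRate i))
        (fun i _ => div_nonneg (abs_nonneg _) (add_nonneg (hq i) (hS i))) (Finset.mem_univ i)
  set g : QState n → ℝ := fun x => net.stageCost q v x (U.mat x) with hg
  have hle : ∀ x, linValue y x ≤ κ * (g x + linValue net.serviceRate x) := by
    intro x
    refine le_trans ?_ (mul_le_mul_of_nonneg_left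
      (add_le_add_left (net.linValue_le_stageCost q hv U x) _) hκ0)
    simp only [linValue, dotProduct]
    rw [← Finset.sum_add_distrib, Finset.mul_sum]
    refine Finset.sum_le_sum fun i _ => ?_
    rw [← add_mul, ← mul_assoc]
    exact mul_le_mul_of_nonneg_right (hκ i) (Nat.cast_nonneg _)
  set N := ∑ i, x₀ i with hN
  set C := (net.cost q v U x₀).toReal with hC
  have hbound : ∀ T, 0 ≤ T → ε * T ≤ κ * (C + linValue (fun _ => 1) x₀) := by
    intro T hT
    have hI := fun f => hP.intervalIntegrable_expect N f hT
    have h1 : ∫ t in (0 : ℝ)..T, expect N (net.law U x₀) g t ≤ C := by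
      rw [← ENNReal.ofReal_le_iff_le_toReal hfin]
      exact (net.costUpTo_eq hq hv U x₀ hT).symm.le.trans (net.costUpTo_le_cost q v U x₀ T)
    -- Dynkin's formula for the total population: the expected number of exits is at most the
    -- initial number of units.
    have h2 : ∫ t in (0 : ℝ)..T, expect N (net.law U x₀) (linValue net.serviceRate) t ≤
        linValue (fun _ => 1) x₀ := by
      have h := hP.dynkin (fun _ => 1) hT
      have hd : net.drift U (fun _ => 1) = fun x => -1 * linValue net.serviceRate x :=
        funext (net.drift_one U)
      simp only [hd, expect_const_mul, intervalIntegral.integral_const_mul] at h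
      have := expect_nonneg (P := net.law U x₀) N
        (linValue_nonneg (n := n) (y := fun _ => 1) fun _ => zero_le_one) T
      linarith
    calc ε * T = ∫ t in (0 : ℝ)..T, ε := by simp [mul_comm]
      _ ≤ ∫ t in (0 : ℝ)..T, κ * (expect N (net.law U x₀) g t +
            expect N (net.law U x₀) (linValue net.serviceRate) t) := by
          refine intervalIntegral.integral_mono_on hT intervalIntegrable_const
            (((hI _).add (hI _)).const_mul κ) fun t ht => ?_
          rw [← expect_add, ← expect_const_mul]
          exact (hlarge t ht.1).trans (expect_mono N hle t)
      _ ≤ κ * (C + linValue (fun _ => 1) x₀) := by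
          rw [intervalIntegral.integral_const_mul, intervalIntegral.integral_add (hI _) (hI _)]
          exact mul_le_mul_of_nonneg_left (add_le_add h1 h2) hκ0
  set K := κ * (C + linValue (fun _ => 1) x₀) with hK
  have hK0 : 0 ≤ K := by simpa using hbound 0 le_rfl
  -- At this horizon `ε * T = K + ε`, which exceeds the uniform bound `K`.
  have h := hbound (K / ε + 1) (by positivity)
  rw [mul_add, mul_div_cancel₀ _ hε.ne'] at h
  linarith

theorem ofReal_linValue_le_cost {q : Fin n → ℝ} (hq : ∀ i, 0 ≤ q i) {v : Fin mD → ℝ}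
    (hv : ∀ k, 0 ≤ v k) {y : Fin n → ℝ} (hy : net.SolvesAlgebraicEq umax q v y)
    (hnorm : ∀ i, q i = 0 → net.serviceRate i = 0 → y i = 0)
    (U : FeedbackPolicy n mD umax) (x₀ : QState n) :
    ENNReal.ofReal (linValue y x₀) ≤ net.cost q v U x₀ := by
  by_cases hfin : net.cost q v U x₀ = ⊤
  · rw [hfin]; exact le_top
  · rw [ENNReal.ofReal_le_iff_le_toReal hfin]
    refine le_of_forall_pos_lt_add fun ε hε => ?_
    obtain ⟨T, hT, hlt⟩ := net.exists_expect_lt hq hv hnorm U x₀ hfin hε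
    have h := net.ofReal_sub_expect_le_cost hq hv hy U x₀ hT
    rw [ENNReal.ofReal_le_iff_le_toReal hfin] at h
    linarith

/-- With zero residual, the cost up to `T` is `y ⬝ᵥ x₀` minus a nonnegative terminal term. -/
theorem cost_bangBang_le {q : Fin n → ℝ} (hq : ∀ i, 0 ≤ q i) {v : Fin mD → ℝ}
    (hv : ∀ k, 0 ≤ v k) {y : Fin n → ℝ} (hy : net.SolvesAlgebraicEq umax q v y)
    (hy0 : ∀ i, 0 ≤ y i) (humax : 0 ≤ umax) {θ : ℝ} (hθ : θ ∈ Set.Icc (-1 : ℝ) 1)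
    (x₀ : QState n) :
    net.cost q v (net.bangBang humax hθ v y) x₀ ≤ ENNReal.ofReal (linValue y x₀) := by
  refine le_of_tendsto (net.tendsto_costUpTo q v _ x₀) ?_
  filter_upwards [eventually_ge_atTop 0] with T hT
  rw [net.costUpTo_eq hq hv _ x₀ hT, ← net.linValue_sub_expect_eq y _ x₀ hT]
  refine ENNReal.ofReal_le_ofReal ?_
  simp only [net.drift_add_stageCost_bangBang hy humax hθ]
  have := expect_nonneg (P := net.law (net.bangBang humax hθ v y) x₀) (∑ i, x₀ i)
    (linValue_nonneg hy0) T
  simpa [expect] using this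

end QueueNetwork

theorem proposition2 {n mE mD : ℕ} (net : QueueNetwork n mE mD)
    (hreach : net.EveryQueueReachesExit)
    (q : Fin n → ℝ) (hq : ∀ i, 0 ≤ q i) (v : Fin mD → ℝ) (hv : ∀ k, 0 ≤ v k)
    (umax : ℝ) (humax : 0 < umax) :
    (∃ y : Fin n → ℝ, net.SolvesAlgebraicEq umax q v y ∧
      ∀ i, q i = 0 → (∀ j, net.exitQueue j = i → net.exitRate j = 0) → y i = 0) ∧
    ∀ y : Fin n → ℝ, net.SolvesAlgebraicEq umax q v y →
      (∀ i, q i = 0 → (∀ j, net.exitQueue j = i → net.exitRate j = 0) → y i = 0) →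
      ∀ (θ : ℝ) (hθ : θ ∈ Set.Icc (-1 : ℝ) 1) (x₀ : QState n),
        IsLeast (Set.range fun U : FeedbackPolicy n mD umax => net.cost q v U x₀)
          (net.cost q v (net.bangBang humax.le hθ v y) x₀) ∧
        0 ≤ y ⬝ᵥ (fun i => (x₀ i : ℝ)) ∧
        net.cost q v (net.bangBang humax.le hθ v y) x₀ =
          ENNReal.ofReal (y ⬝ᵥ (fun i => (x₀ i : ℝ))) := by
  constructor
  · obtain ⟨y, hy, hy0⟩ := net.exists_normalized_solution hreach humax hq hv
    exact ⟨y, hy, fun i hi _ => hy0 i hi⟩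
  · intro y hy hnorm θ hθ x₀
    have hnorm' : ∀ i, q i = 0 → net.serviceRate i = 0 → y i = 0 := fun i hi hs =>
      hnorm i hi ((net.serviceRate_eq_zero_iff i).1 hs)
    have hy0 := net.solution_nonneg hq hv hy hnorm'
    have hle := net.ofReal_linValue_le_cost hq hv hy hnorm'
    have hge := net.cost_bangBang_le hq hv hy hy0 humax.le hθ x₀
    refine ⟨⟨⟨_, rfl⟩, ?_⟩, QueueNetwork.linValue_nonneg hy0 x₀, hge.antisymm (hle _ x₀)⟩
    rintro _ ⟨U, rfl⟩
    exact hge.trans (hle U x₀)
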